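/- Let $m,n\ge 1$, let $\mathbf W=(w_{ij})\in\mathbb R^{m\times m}$ be a mixing matrix with $\mathbf W=\mathbf W^\top$, $\mathbf W\mathbf 1_m=\mathbf 1_m$, $0\prec\mathbf W\preceq \mathbf I_m$, and let $f_1,\dots,f_m:\mathbb R^n\to\mathbb R$ be twice continuously differentiable. Put $f=\sum_i f_i$ on $\mathbb R^n$, and for $\hat{\mathbf x}=(\hat{\mathbf x}_1,\dots,\hat{\mathbf x}_m)\in(\mathbb R^n)^m$ (Euclidean norm) put $F(\hat{\mathbf x})=\sum_i f_i(\hat{\mathbf x}_i)$, $\operatorname{av}(\hat{\mathbf x})=\frac1m\sum_i\hat{\mathbf x}_i$, $\mathbf 1_m\otimes \mathbf v=(\mathbf v,\dots,\mathbf v)$, and, for $\alpha>0$, $$Q_\alpha(\hat{\mathbf x})=F(\hat{\mathbf x})+\frac1{2\alpha}\sum_{i,j}(\mathbf I_m-\mathbf W)_{ij}\,\hat{\mathbf x}_i^\top\hat{\mathbf x}_j,\qquad \mathcal X^\star_{Q_\alpha}=\{\hat{\mathbf x}:\nabla Q_\alpha(\hat{\mathbf x})=0,\ \nabla^2Q_\alpha(\hat{\mathbf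 x})\succ0\}.$$ Assume the following. (Lipschitz) For all $i$ and all $\mathbf x,\mathbf y\in\mathbb R^n$: $\|\nabla f_i(\mathbf x)-\nabla f_i(\mathbf y)\|\le L^g_{f_i}\|\mathbf x-\mathbf y\|$ and $\|\nabla^2 f_i(\mathbf x)-\nabla^2 f_i(\mathbf y)\|\le L^H_{f_i}\|\mathbf x-\mathbf y\|$; and $L_F^g:=\max_iL^g_{f_i}>0$, $L_F^H:=\max_iL^H_{f_i}>0$. (Coercivity) Each $f_i$ is coercive, and $\|\nabla f\|$ is coercive. Let $f_i^\star$ be the global minimum of $f_i$. (Local regularity) $\alpha',\gamma,\delta,\epsilon,\eta,\mu>0$ are constants such that every $\hat{\mathbf x}\in(\mathbb R^n)^m$ with $\|\hat{\mathbf x}-\mathbf 1_m\otimes\operatorname{av}(\hat{\mathbf x})\|\le\eta$ satisfies at least one of: (a) $\|\sum_i\nabla f_i(\hat{\mathbf x}_i)\|>\epsilon$; (b) $\lambda_{\min}(\sum_i\nabla^2f_i(\hat{\mathbf x}_i))<-\gamma$; (c) for every $0<\alpha\le\alpha'$ there is $\hat{\mathbf x}'$ with $\|\hat{\mathbf x}'-\hat{\mathbf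 x}\|\le\delta$, $\sum_jw_{ij}(\hat{\mathbf x}'_j-\hat{\mathbf x}'_i)=\alpha\nabla f_i(\hat{\mathbf x}'_i)$ for all $i$, and $\lambda_{\min}(\nabla^2F(\hat{\mathbf y}))\ge\mu$ for all $\hat{\mathbf y}$ with $\|\hat{\mathbf y}-\hat{\mathbf x}'\|\le3\delta$. For $\rho\ge1$ let $$\alpha=\frac{\lambda_{\min}(\mathbf W)}{L_F^g}\sqrt{\frac1\rho},\qquad \sigma=\frac1{40\sqrt{mn}\,L_F^H}\,\alpha\,\Big(\frac1\rho\Big)^3 .$$ Then there is $\rho_4\ge1$ such that for every $\rho\ge\rho_4$: (i) $0<\alpha\le\alpha'$; (ii) $\delta\ge\sqrt\alpha/\mu$; (iii) for every initial point $\hat{\mathbf x}^0$ with $\|\hat{\mathbf x}^0-\mathbf 1_m\otimes\operatorname{av}(\hat{\mathbf x}^0)\|\le\eta$ and $\operatorname{dist}(\hat{\mathbf x}^0,\mathcal X^\star_{Q_\alpha})\le\sqrt\alpha/\mu$ (where $\operatorname{dist}(\cdot,\emptyset)=+\infty$), there is $\hat{\mathbf x}^\star\in\mathcal X^\star_{Q_\alpha}$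 with $\|\hat{\mathbf x}^0-\hat{\mathbf x}^\star\|\le\sqrt\alpha/\mu$ such that, with $$K=\Big\lceil\Big(Q_\alpha(\hat{\mathbf x}^0)-\sum_if_i^\star\Big)\alpha^{-4}\rho^5\Big\rceil,$$ the iterates $$\hat{\mathbf x}_i^{k+1}=\sum_jw_{ij}\hat{\mathbf x}_j^k-\alpha\big(\nabla f_i(\hat{\mathbf x}_i^k)+\mathbf n_i^k\big),\qquad k\ge0,\ 1\le i\le m,$$ driven by any random perturbations with $\mathbf n_i^k\sim\mathcal N(0,\sigma^2\mathbf I_n)$ for all $k\ge0$ and all $i$ (in particular by independent ones) satisfy $$\mathbb P\Big[\forall k\in\{1,\dots,K\}:\ \|\hat{\mathbf x}^k-\hat{\mathbf x}^\star\|\le\frac2\mu\sqrt\alpha\Big]\ \ge\ 1-K(K+1)e^{-\rho}.$$ -/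

import Mathlib

open MeasureTheory ProbabilityTheory

namespace NDGD

noncomputable section

/-- The decision space `ℝⁿ` with its Euclidean norm. -/
abbrev Vec (n : ℕ) : Type := EuclideanSpace ℝ (Fin n)

/-- The lifted space `(ℝⁿ)ᵐ` with its Euclidean norm. -/
abbrev Lifted (m n : ℕ) : Type := PiLp 2 (fun _ : Fin m => Vec n)

/-- The Hessian `∇² h (x)` as an operator, i.e. the derivative of the gradient. Its norm is the
spectral norm. -/
def hessian {E : Type*} [NormedAddCommGroup E] [InnerProductSpace ℝ E] [CompleteSpace E]
    (h : E → ℝ) (x : E) : E →L[ℝ] E :=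
  fderiv ℝ (gradient h) x

/-- The smallest eigenvalue `λ_min` (used for self-adjoint operators on nonzero
finite-dimensional spaces, where the set below is finite and nonempty). -/
def lambdaMin {E : Type*} [AddCommGroup E] [Module ℝ E] (T : E →ₗ[ℝ] E) : ℝ :=
  sInf {c : ℝ | Module.End.HasEigenvalue T c}

/-- `λ_min` of a square real matrix. -/
def matLambdaMin {m : ℕ} (W : Matrix (Fin m) (Fin m) ℝ) : ℝ :=
  lambdaMin (Matrix.toLin' W)

/-- The global minimum of `h` (attained when `h` is continuous and coercive). -/
def globalMin {E : Type*} (h : E → ℝ) : ℝ := ⨅ x, h x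

/-- The average `av(x) = (1/m) ∑ᵢ xᵢ`. -/
def av {m n : ℕ} (x : Lifted m n) : Vec n := (1 / (m : ℝ)) • ∑ i, x i

/-- The consensual vector `1ₘ ⊗ v`. -/
def consensus (m : ℕ) {n : ℕ} (v : Vec n) : Lifted m n := WithLp.toLp 2 (fun _ => v)

/-- The objective `f(x) = ∑ᵢ fᵢ(x)`. -/
def objective {m n : ℕ} (f : Fin m → Vec n → ℝ) (x : Vec n) : ℝ := ∑ i, f i x

/-- The lifted objective `F(x) = ∑ᵢ fᵢ(xᵢ)`. -/
def liftedObjective {m n : ℕ} (f : Fin m → Vec n → ℝ) (x : Lifted m n) : ℝ := ∑ i, f i (x i)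

/-- `Q_α(x) = ∑ᵢ fᵢ(xᵢ) + (1/(2α)) ∑ᵢⱼ (I - W)ᵢⱼ xᵢᵀ xⱼ`. -/
def Q {m n : ℕ} (W : Matrix (Fin m) (Fin m) ℝ) (f : Fin m → Vec n → ℝ) (α : ℝ)
    (x : Lifted m n) : ℝ :=
  ∑ i, f i (x i) +
    1 / (2 * α) * ∑ i, ∑ j, (1 - W : Matrix (Fin m) (Fin m) ℝ) i j * inner ℝ (x i) (x j)

/-- The set of local minimizers of `h` in the second-order sense: `∇h(x) = 0`, `∇²h(x) ≻ 0`. -/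
def localMinimizers {E : Type*} [NormedAddCommGroup E] [InnerProductSpace ℝ E] [CompleteSpace E]
    (h : E → ℝ) : Set E :=
  {x | gradient h x = 0 ∧ 0 < lambdaMin (hessian h x : E →ₗ[ℝ] E)}

/-- Standing conditions on the mixing matrix: `W = Wᵀ`, `W 1 = 1`, `0 ≺ W ≼ I`. -/
structure IsMixing {m : ℕ} (W : Matrix (Fin m) (Fin m) ℝ) : Prop where
  symm : W.transpose = W
  mulVec_one : W.mulVec 1 = 1
  pos : 0 < matLambdaMin W
  le_one : 0 ≤ matLambdaMin (1 - W)

/-- Each `fᵢ` has `Lg i`-Lipschitz gradient and `LH i`-Lipschitz Hessian. -/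
def LipschitzAssumption {m n : ℕ} (f : Fin m → Vec n → ℝ) (Lg LH : Fin m → ℝ) : Prop :=
  ∀ i, ∀ x y : Vec n,
    ‖gradient (f i) x - gradient (f i) y‖ ≤ Lg i * ‖x - y‖ ∧
    ‖hessian (f i) x - hessian (f i) y‖ ≤ LH i * ‖x - y‖

/-- Each `fᵢ` is coercive, and so is `‖∇f‖`. -/
def CoercivityAssumption {m n : ℕ} (f : Fin m → Vec n → ℝ) : Prop :=
  (∀ i, Filter.Tendsto (f i) (Bornology.cobounded (Vec n)) Filter.atTop) ∧
  Filter.Tendsto (fun x => ‖gradient (objective f) x‖) (Bornology.cobounded (Vec n)) Filter.atTop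

/-- Local regularity with constants `α', γ, δ, ε, η, μ`. -/
def LocalRegularity {m n : ℕ} (W : Matrix (Fin m) (Fin m) ℝ) (f : Fin m → Vec n → ℝ)
    (α' γ δ ε η μ : ℝ) : Prop :=
  ∀ x : Lifted m n, ‖x - consensus m (av x)‖ ≤ η →
    ε < ‖∑ i, gradient (f i) (x i)‖ ∨
    lambdaMin ((∑ i, hessian (f i) (x i) : Vec n →L[ℝ] Vec n) : Vec n →ₗ[ℝ] Vec n) < -γ ∨
    ∀ α : ℝ, 0 < α → α ≤ α' → ∃ x' : Lifted m n, ‖x' - x‖ ≤ δ ∧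
      (∀ i, ∑ j, W i j • (x' j - x' i) = α • gradient (f i) (x' i)) ∧
      ∀ y : Lifted m n, ‖y - x'‖ ≤ 3 * δ →
        μ ≤ lambdaMin (hessian (liftedObjective f) y : Lifted m n →ₗ[ℝ] Lifted m n)

/-- `L_F = maxᵢ Lᵢ`. -/
def maxConst {m : ℕ} (L : Fin m → ℝ) : ℝ := ⨆ i, L i

/-- The step size `α = (λ_min(W) / L_F^g) √(1/ρ)`. -/
def stepSize {m : ℕ} (W : Matrix (Fin m) (Fin m) ℝ) (Lg : Fin m → ℝ) (ρ : ℝ) : ℝ :=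
  matLambdaMin W / maxConst Lg * Real.sqrt (1 / ρ)

/-- The noise level `σ = (1 / (40 √(mn) L_F^H)) α (1/ρ)³`. -/
def noiseLevel {m : ℕ} (n : ℕ) (W : Matrix (Fin m) (Fin m) ℝ) (Lg LH : Fin m → ℝ) (ρ : ℝ) : ℝ :=
  1 / (40 * Real.sqrt ((m : ℝ) * n) * maxConst LH) * stepSize W Lg ρ * (1 / ρ) ^ 3

/-- The iteration count `K = ⌈(Q_α(x⁰) - ∑ᵢ fᵢ⋆) α⁻⁴ ρ⁵⌉`. The argument of the ceiling is
nonnegative for mixing matrices and coercive continuous `fᵢ`. -/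
def numIter {m n : ℕ} (W : Matrix (Fin m) (Fin m) ℝ) (f : Fin m → Vec n → ℝ) (α ρ : ℝ)
    (x₀ : Lifted m n) : ℕ :=
  ⌈(Q W f α x₀ - ∑ i, globalMin (f i)) * (α ^ 4)⁻¹ * ρ ^ 5⌉₊

/-- The NDGD iterates for a given noise realization `ν`:
`xᵢᵏ⁺¹ = ∑ⱼ wᵢⱼ xⱼᵏ - α (∇fᵢ(xᵢᵏ) + νᵢᵏ)`. -/
def iterate {m n : ℕ} (W : Matrix (Fin m) (Fin m) ℝ) (f : Fin m → Vec n → ℝ) (α : ℝ)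
    (x₀ : Lifted m n) (ν : ℕ → Fin m → Vec n) : ℕ → Lifted m n
  | 0 => x₀
  | k + 1 => WithLp.toLp 2 (fun i =>
      ∑ j, W i j • iterate W f α x₀ ν k j
        - α • (gradient (f i) (iterate W f α x₀ ν k i) + ν k i))

/-- The perturbations satisfy `nᵢᵏ ∼ N(0, σ² Iₙ)` for all `k` and `i`. -/
def GaussianNoise {m n : ℕ} {Ω : Type*} [MeasurableSpace Ω] (σ : ℝ)
    (noise : ℕ → Fin m → Ω → Vec n) (P : Measure Ω) : Prop :=
  ∀ k i, HasLaw (noise k i)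
    (multivariateGaussian 0 (σ ^ 2 • (1 : Matrix (Fin n) (Fin n) ℝ))) P

end

end NDGD

/-! The noiseless update `step` is a gradient step of length `α` on `Q_α`, so critical points of
`Q_α` are fixed points. At a local minimizer `z` of `Q_α` the gradients `∇fᵢ(zᵢ)` sum to zero and
the Hessians `∇²fᵢ(zᵢ)` sum to a positive semidefinite operator. By Lipschitz continuity,
alternatives (a) and (b) of local regularity fail at `x₀` once `α` is small, and (c) gives a fixed
point `x'` with `∇²F ≽ μ` on the ball of radius `3δ` (`LocalRegularity.exists_critical`).

There the derivative `W ⊗ I - α∇²F` of `step` lies between `0` and `1 - αμ`, so `step` contracts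
(`norm_step_sub_le`). Hence fixed points in the ball are unique, and `z = x'`.

Noise of norm at most `2√α` leaves the ball of radius `2√α/μ` about `x'` invariant
(`norm_iterate_sub_le`). A union bound over Gaussian coordinates shows that larger noise within `K`
steps has probability at most `K e^{-ρ}` (`GaussianNoise.measureReal_forall_norm_le`,
`gaussian_tail_le`). -/

namespace NDGD

/-! ### Rayleigh quotients and operator norms of symmetric operators. -/

section LinearAlgebra

variable {E : Type*} [NormedAddCommGroup E] [InnerProductSpace ℝ E]

theorem lambdaMin_le_of_hasEigenvalue [FiniteDimensional ℝ E] {T : E →ₗ[ℝ] E} {c : ℝ}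
    (hc : Module.End.HasEigenvalue T c) : lambdaMin T ≤ c :=
  csInf_le (Module.End.finite_hasEigenvalue T).bddBelow hc

/-- A symmetric operator whose eigenvalues are all at least `c` has Rayleigh quotient at
least `c`. -/
theorem mul_norm_sq_le_inner_of_eigenvalues [FiniteDimensional ℝ E] {T : E →L[ℝ] E}
    (hT : ∀ v w, inner ℝ (T v) w = inner ℝ v (T w)) {c : ℝ}
    (hc : ∀ d, Module.End.HasEigenvalue (T : E →ₗ[ℝ] E) d → c ≤ d) (v : E) :
    c * ‖v‖ ^ 2 ≤ inner ℝ (T v) v := by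
  rcases eq_or_ne v 0 with rfl | hv
  · simp
  have : Nontrivial E := ⟨v, 0, hv⟩
  have hS : (T : E →ₗ[ℝ] E).IsSymmetric := fun v w => hT v w
  -- In finite dimension the infimum of the Rayleigh quotient is itself an eigenvalue.
  have h := hc _ hS.hasEigenvalue_iInf_of_finiteDimensional
  have hv' : 0 < ‖v‖ ^ 2 := by positivity
  rw [← le_div_iff₀ hv']
  refine h.trans (ciInf_le (f := fun x : {x : E // x ≠ 0} =>
    inner ℝ (T (x : E)) (x : E) / ‖(x : E)‖ ^ 2) ⟨-‖T‖, ?_⟩ ⟨v, hv⟩)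
  rintro _ ⟨⟨x, hx⟩, rfl⟩
  have hx' : 0 < ‖x‖ ^ 2 := by positivity
  simp only
  rw [le_div_iff₀ hx']
  have h1 := abs_le.1 (abs_real_inner_le_norm (T x) x)
  have h2 := T.le_opNorm x
  nlinarith [norm_nonneg x]

theorem lambdaMin_mul_norm_sq_le_inner [FiniteDimensional ℝ E] {T : E →L[ℝ] E}
    (hT : ∀ v w, inner ℝ (T v) w = inner ℝ v (T w)) (v : E) :
    lambdaMin (T : E →ₗ[ℝ] E) * ‖v‖ ^ 2 ≤ inner ℝ (T v) v :=
  mul_norm_sq_le_inner_of_eigenvalues hT (fun _ => lambdaMin_le_of_hasEigenvalue) v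

/-- If the smallest eigenvalue is below a negative number, then so is the Rayleigh quotient of
some nonzero vector. -/
theorem exists_inner_lt_of_lambdaMin_lt {T : E →L[ℝ] E} {c : ℝ} (hc : c ≤ 0)
    (h : lambdaMin (T : E →ₗ[ℝ] E) < c) : ∃ v : E, v ≠ 0 ∧ inner ℝ (T v) v < c * ‖v‖ ^ 2 := by
  -- An empty spectrum would give the default `sInf ∅ = 0`, which `c ≤ 0` excludes.
  have hne : {d : ℝ | Module.End.HasEigenvalue (T : E →ₗ[ℝ] E) d}.Nonempty := by
    by_contra hne
    rw [lambdaMin, Set.not_nonempty_iff_eq_empty.1 hne, Real.sInf_empty] at h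
    linarith
  obtain ⟨d, hd, hdc⟩ := exists_lt_of_csInf_lt hne h
  obtain ⟨v, hv⟩ := hd.exists_hasEigenvector
  have hTv : T v = d • v := hv.apply_eq_smul
  have hv0 : 0 < ‖v‖ := norm_pos_iff.2 hv.2
  refine ⟨v, hv.2, ?_⟩
  rw [hTv, real_inner_smul_left, real_inner_self_eq_norm_sq]
  gcongr

/-- Polarization: rescale `T v` to a vector `w` of norm `‖v‖`; then `4⟨T v, w⟩` is at most the
quadratic form at `v + w`, hence at most `4c‖v‖²`. -/
theorem opNorm_le_of_inner_le {T : E →L[ℝ] E}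
    (hT : ∀ v w, inner ℝ (T v) w = inner ℝ v (T w)) {c : ℝ} (hc : 0 ≤ c)
    (h0 : ∀ v, 0 ≤ inner ℝ (T v) v) (h1 : ∀ v, inner ℝ (T v) v ≤ c * ‖v‖ ^ 2) : ‖T‖ ≤ c := by
  refine T.opNorm_le_bound hc fun v => ?_
  rcases eq_or_ne (T v) 0 with ha | ha
  · rw [ha, norm_zero]; positivity
  rcases eq_or_ne v 0 with rfl | hb
  · simp
  have ha' : 0 < ‖T v‖ := norm_pos_iff.2 ha
  have hb' : 0 < ‖v‖ := norm_pos_iff.2 hb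
  obtain ⟨w, hw⟩ : ∃ w, w = (‖v‖ / ‖T v‖) • T v := ⟨_, rfl⟩
  have hwn : ‖w‖ = ‖v‖ := by
    rw [hw, norm_smul, norm_div, norm_norm, norm_norm]; field_simp
  have hin : inner ℝ (T v) w = ‖T v‖ * ‖v‖ := by
    rw [hw, real_inner_smul_right, real_inner_self_eq_norm_sq]; field_simp
  have hpol : 4 * inner ℝ (T v) w = inner ℝ (T (v + w)) (v + w) - inner ℝ (T (v - w)) (v - w) := by
    simp only [map_add, map_sub, inner_add_left, inner_add_right, inner_sub_left, inner_sub_right]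
    rw [hT w v, real_inner_comm (T v) w]
    ring
  have h2 := h1 (v + w)
  have h3 := h0 (v - w)
  have h4 : ‖v + w‖ ^ 2 ≤ (2 * ‖v‖) ^ 2 := by
    gcongr
    calc ‖v + w‖ ≤ ‖v‖ + ‖w‖ := norm_add_le _ _
      _ = 2 * ‖v‖ := by rw [hwn]; ring
  have h5 : ‖T v‖ * ‖v‖ ≤ (c * ‖v‖) * ‖v‖ := by
    nlinarith [mul_le_mul_of_nonneg_left h4 hc]
  exact le_of_mul_le_mul_right h5 hb'

end LinearAlgebra

/-! ### Gradients and Hessians in a Hilbert space. -/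

section Calculus

variable {E : Type*} [NormedAddCommGroup E] [InnerProductSpace ℝ E] [CompleteSpace E]

theorem contDiff_gradient {h : E → ℝ} (hh : ContDiff ℝ 2 h) : ContDiff ℝ 1 (gradient h) := by
  have h1 : ContDiff ℝ 1 (fderiv ℝ h) := hh.fderiv_right (by norm_num)
  exact ((InnerProductSpace.toDual ℝ E).symm.toContinuousLinearEquiv.contDiff).comp h1

theorem hasFDerivAt_gradient {h : E → ℝ} (hh : ContDiff ℝ 2 h) (x : E) :
    HasFDerivAt (gradient h) (hessian h x) x :=
  ((contDiff_gradient hh).differentiable (by norm_num) x).hasFDerivAt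

/-- Links the derivative of the gradient to the second Fréchet derivative, whose symmetry then
passes to `hessian`. -/
theorem inner_hessian_eq {h : E → ℝ} (hh : ContDiff ℝ 2 h) (x v w : E) :
    inner ℝ (hessian h x v) w = fderiv ℝ (fderiv ℝ h) x v w := by
  have h1 : HasFDerivAt (fun y => fderiv ℝ h y w) ((innerSL ℝ w).comp (hessian h x)) x := by
    have h2 := (innerSL ℝ w).hasFDerivAt.comp x (hasFDerivAt_gradient hh x)
    have h3 : (innerSL ℝ w) ∘ gradient h = fun y => fderiv ℝ h y w := by
      funext y
      rw [← toDual_gradient]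
      exact real_inner_comm _ _
    rwa [h3] at h2
  have h4 := ((hh.fderiv_right (m := 1) (by norm_num)).differentiable (by norm_num)
    x).hasFDerivAt.clm_apply (hasFDerivAt_const w x)
  have h5 := congrArg (fun T : E →L[ℝ] ℝ => T v) (h1.unique h4)
  simpa [real_inner_comm] using h5

theorem hessian_symm {h : E → ℝ} (hh : ContDiff ℝ 2 h) (x v w : E) :
    inner ℝ (hessian h x v) w = inner ℝ v (hessian h x w) := by
  rw [real_inner_comm (hessian h x w) v, inner_hessian_eq hh, inner_hessian_eq hh]
  exact (hh.contDiffAt.isSymmSndFDerivAt (by simp)).eq v w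

/-- The gradient of `h`, expressed through the Riesz representation, as an inner product. -/
theorem inner_gradient_eq (h : E → ℝ) (x v : E) : inner ℝ (gradient h x) v = fderiv ℝ h x v := by
  rw [← toDual_gradient]
  rfl

/-- Differentiating an intertwining relation. With coordinate projections for `p`, it shows that the
Hessian of `F` acts blockwise. -/
theorem fderiv_apply_of_comp_eq {F : Type*} [NormedAddCommGroup F] [NormedSpace ℝ F]
    {G : Type*} [NormedAddCommGroup G] [NormedSpace ℝ G] {φ : F → F} {ψ : G → G} {p : F →L[ℝ] G} (h : ∀ y, p (φ y) = ψ (p y))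
    {x : F} {φ' : F →L[ℝ] F} {ψ' : G →L[ℝ] G} (hφ : HasFDerivAt φ φ' x)
    (hψ : HasFDerivAt ψ ψ' (p x)) (v : F) : p (φ' v) = ψ' (p v) := by
  have h1 := p.hasFDerivAt.comp x hφ
  have h2 := hψ.comp x p.hasFDerivAt
  have h3 : p ∘ φ = ψ ∘ p := funext h
  rw [h3] at h1
  exact congrArg (fun T : F →L[ℝ] G => T v) (h1.unique h2)

theorem norm_hessian_le {h : E → ℝ} {C : ℝ} (hC : 0 ≤ C)
    (hh : ∀ x y, ‖gradient h x - gradient h y‖ ≤ C * ‖x - y‖) (x : E) : ‖hessian h x‖ ≤ C :=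
  norm_fderiv_le_of_lip' ℝ hC (Filter.Eventually.of_forall fun y => hh y x)

theorem gradient_add_inner {h : E → ℝ} (hh : ContDiff ℝ 2 h) {T : E →L[ℝ] E}
    (hT : ∀ v w, inner ℝ (T v) w = inner ℝ v (T w)) (α : ℝ) :
    gradient (fun x => h x + 1 / (2 * α) * inner ℝ x (T x)) =
      fun x => gradient h x + (1 / α) • T x := by
  refine gradient_eq fun x => ?_
  rw [hasGradientAt_iff_hasFDerivAt]
  have h1 := (hh.differentiable (by norm_num) x).hasFDerivAt
  have h2 := ((hasFDerivAt_id x).inner ℝ T.hasFDerivAt).const_mul (1 / (2 * α))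
  refine (h1.add h2).congr_fderiv (ContinuousLinearMap.ext fun v => ?_)
  have h3 : inner ℝ x (T v) = inner ℝ v (T x) := by rw [← hT, real_inner_comm]
  have h4 : inner ℝ (T x) v = inner ℝ v (T x) := real_inner_comm _ _
  rw [InnerProductSpace.toDual_apply_apply, inner_add_left, inner_gradient_eq,
    real_inner_smul_left, h4]
  simp [fderivInnerCLM_apply, h3]
  ring

theorem hessian_add_inner {h : E → ℝ} (hh : ContDiff ℝ 2 h) {T : E →L[ℝ] E}
    (hT : ∀ v w, inner ℝ (T v) w = inner ℝ v (T w)) (α : ℝ) (x : E) :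
    hessian (fun x => h x + 1 / (2 * α) * inner ℝ x (T x)) x = hessian h x + (1 / α) • T := by
  rw [hessian, gradient_add_inner hh hT]
  exact ((hasFDerivAt_gradient hh x).add (T.hasFDerivAt.const_smul (1 / α))).fderiv

end Calculus

/-! ### The lifted space: `A ⊗ Iₙ`, `F` and `Q_α`. -/

section Lifted

variable {m n : ℕ}

/-- The operator `A ⊗ Iₙ` on the lifted space. -/
noncomputable def liftMatrix (n : ℕ) (A : Matrix (Fin m) (Fin m) ℝ) :
    Lifted m n →L[ℝ] Lifted m n :=
  (PiLp.continuousLinearEquiv 2 ℝ (fun _ : Fin m => Vec n)).symm.toContinuousLinearMap.comp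
    (ContinuousLinearMap.pi fun i => ∑ j, A i j • PiLp.proj 2 (fun _ : Fin m => Vec n) j)

theorem liftMatrix_apply (A : Matrix (Fin m) (Fin m) ℝ) (x : Lifted m n) (i : Fin m) :
    liftMatrix n A x i = ∑ j, A i j • x j := by
  simp [liftMatrix]

theorem inner_liftMatrix (A : Matrix (Fin m) (Fin m) ℝ) (x y : Lifted m n) :
    inner ℝ x (liftMatrix n A y) = ∑ i, ∑ j, A i j * inner ℝ (x i) (y j) := by
  simp_rw [PiLp.inner_apply x, liftMatrix_apply, inner_sum, real_inner_smul_right]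

theorem liftMatrix_symm {A : Matrix (Fin m) (Fin m) ℝ} (hA : A.transpose = A)
    (x y : Lifted m n) : inner ℝ (liftMatrix n A x) y = inner ℝ x (liftMatrix n A y) := by
  rw [real_inner_comm, inner_liftMatrix, inner_liftMatrix, Finset.sum_comm]
  refine Finset.sum_congr rfl fun i _ => Finset.sum_congr rfl fun j _ => ?_
  rw [real_inner_comm, ← hA, Matrix.transpose_apply, hA]

/-- Fixing a coordinate `l` where the eigenvector is nonzero, its slice over the agents is an
eigenvector of `A`. -/
theorem hasEigenvalue_of_liftMatrix {A : Matrix (Fin m) (Fin m) ℝ} {c : ℝ}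
    (h : Module.End.HasEigenvalue (liftMatrix n A : Lifted m n →ₗ[ℝ] Lifted m n) c) :
    Module.End.HasEigenvalue (Matrix.toLin' A) c := by
  obtain ⟨v, hv⟩ := h.exists_hasEigenvector
  have hAv : liftMatrix n A v = c • v := hv.apply_eq_smul
  obtain ⟨i, l, hil⟩ : ∃ i l, v i l ≠ 0 := by
    by_contra! H
    exact hv.2 (by ext i l; exact H i l)
  refine Module.End.hasEigenvalue_of_hasEigenvector (x := fun j => v j l)
    ⟨Module.End.mem_eigenspace_iff.2 ?_, fun h0 => hil (congrFun h0 i)⟩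
  funext k
  have := congrArg (fun y : Lifted m n => y k l) hAv
  simpa [liftMatrix_apply, Matrix.mulVec, dotProduct] using this

theorem matLambdaMin_mul_le_inner {A : Matrix (Fin m) (Fin m) ℝ} (hA : A.transpose = A)
    (x : Lifted m n) : matLambdaMin A * ‖x‖ ^ 2 ≤ inner ℝ (liftMatrix n A x) x :=
  mul_norm_sq_le_inner_of_eigenvalues (liftMatrix_symm hA) (fun _ hd =>
    csInf_le (Module.End.finite_hasEigenvalue _).bddBelow (hasEigenvalue_of_liftMatrix hd)) x

theorem liftMatrix_one_sub (A : Matrix (Fin m) (Fin m) ℝ) (x : Lifted m n) :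
    liftMatrix n (1 - A) x = x - liftMatrix n A x := by
  refine PiLp.ext fun i => ?_
  simp [liftMatrix_apply, sub_smul, Matrix.one_apply, Finset.sum_sub_distrib, ite_smul]

variable {f : Fin m → Vec n → ℝ}

theorem hasGradientAt_liftedObjective (hf : ∀ i, ContDiff ℝ 2 (f i)) (x : Lifted m n) :
    HasGradientAt (liftedObjective f) (WithLp.toLp 2 fun i => gradient (f i) (x i)) x := by
  rw [hasGradientAt_iff_hasFDerivAt]
  have h : HasFDerivAt (liftedObjective f)
      (∑ i, (fderiv ℝ (f i) (x i)).comp (PiLp.proj 2 (fun _ : Fin m => Vec n) i)) x := by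
    refine HasFDerivAt.fun_sum fun i _ => ?_
    exact (((hf i).differentiable (by norm_num)) (x i)).hasFDerivAt.comp x
      (PiLp.proj 2 (fun _ : Fin m => Vec n) i : Lifted m n →L[ℝ] Vec n).hasFDerivAt
  refine h.congr_fderiv (ContinuousLinearMap.ext fun v => ?_)
  rw [InnerProductSpace.toDual_apply_apply, PiLp.inner_apply, sum_apply]
  exact Finset.sum_congr rfl fun i _ => (inner_gradient_eq _ _ _).symm

theorem gradient_liftedObjective (hf : ∀ i, ContDiff ℝ 2 (f i)) :
    gradient (liftedObjective f) =
      fun x : Lifted m n => WithLp.toLp 2 fun i => gradient (f i) (x i) :=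
  gradient_eq (hasGradientAt_liftedObjective hf)

theorem contDiff_liftedObjective (hf : ∀ i, ContDiff ℝ 2 (f i)) :
    ContDiff ℝ 2 (liftedObjective f) := by
  refine ContDiff.sum fun i _ => (hf i).comp ?_
  exact (PiLp.proj 2 (fun _ : Fin m => Vec n) i : Lifted m n →L[ℝ] Vec n).contDiff

theorem hessian_liftedObjective_apply (hf : ∀ i, ContDiff ℝ 2 (f i)) (x v : Lifted m n)
    (i : Fin m) : hessian (liftedObjective f) x v i = hessian (f i) (x i) (v i) := by
  refine fderiv_apply_of_comp_eq (p := PiLp.proj 2 (fun _ : Fin m => Vec n) i)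
    (φ := gradient (liftedObjective f)) (ψ := gradient (f i)) (fun y => ?_)
    (hasFDerivAt_gradient (contDiff_liftedObjective hf) x) (hasFDerivAt_gradient (hf i) (x i)) v
  rw [gradient_liftedObjective hf]
  rfl

theorem inner_hessian_liftedObjective_le (hf : ∀ i, ContDiff ℝ 2 (f i)) {C : ℝ} (hC : 0 ≤ C)
    (hLip : ∀ i x y, ‖gradient (f i) x - gradient (f i) y‖ ≤ C * ‖x - y‖) (x v : Lifted m n) :
    inner ℝ (hessian (liftedObjective f) x v) v ≤ C * ‖v‖ ^ 2 := by
  rw [PiLp.inner_apply, PiLp.norm_sq_eq_of_L2, Finset.mul_sum]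
  refine Finset.sum_le_sum fun i _ => ?_
  rw [hessian_liftedObjective_apply hf]
  calc inner ℝ (hessian (f i) (x i) (v i)) (v i)
      ≤ ‖hessian (f i) (x i) (v i)‖ * ‖v i‖ := real_inner_le_norm _ _
    _ ≤ C * ‖v i‖ * ‖v i‖ := by
        gcongr
        exact (ContinuousLinearMap.le_opNorm _ _).trans
          (by gcongr; exact norm_hessian_le hC (hLip i) _)
    _ = C * ‖v i‖ ^ 2 := by ring

variable {W : Matrix (Fin m) (Fin m) ℝ}

theorem Q_eq (α : ℝ) : Q W f α = fun x : Lifted m n =>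
    liftedObjective f x + 1 / (2 * α) * inner ℝ x (liftMatrix n (1 - W) x) := by
  funext x
  rw [inner_liftMatrix]
  rfl

theorem contDiff_Q (hf : ∀ i, ContDiff ℝ 2 (f i)) (α : ℝ) :
    ContDiff ℝ 2 (Q W f α : Lifted m n → ℝ) := by
  rw [Q_eq]
  exact (contDiff_liftedObjective hf).add
    (contDiff_const.mul (contDiff_id.inner ℝ (liftMatrix n (1 - W)).contDiff))

theorem gradient_Q (hf : ∀ i, ContDiff ℝ 2 (f i)) (hW : W.transpose = W) (α : ℝ) :
    gradient (Q W f α) = fun x : Lifted m n =>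
      gradient (liftedObjective f) x + (1 / α) • liftMatrix n (1 - W) x := by
  rw [Q_eq]
  exact gradient_add_inner (contDiff_liftedObjective hf) (liftMatrix_symm (by simp [hW])) α

theorem hessian_Q (hf : ∀ i, ContDiff ℝ 2 (f i)) (hW : W.transpose = W) (α : ℝ)
    (x : Lifted m n) : hessian (Q W f α) x =
      hessian (liftedObjective f) x + (1 / α) • liftMatrix n (1 - W) := by
  rw [Q_eq]
  exact hessian_add_inner (contDiff_liftedObjective hf) (liftMatrix_symm (by simp [hW])) α x

end Lifted

/-! ### Gaussian tails and the union bound. -/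

section Probability

theorem hasSubgaussianMGF_gaussianReal {Ω : Type*} [MeasurableSpace Ω] {P : Measure Ω}
    {X : Ω → ℝ} {v : NNReal} (hX : HasLaw X (gaussianReal 0 v) P) : HasSubgaussianMGF X v P where
  integrable_exp_mul t := by
    have h := integrable_exp_mul_gaussianReal (μ := 0) (v := v) t
    rw [← hX.map_eq] at h
    exact h.comp_aemeasurable hX.aemeasurable
  mgf_le t := by rw [mgf_gaussianReal hX.map_eq]; simp

theorem measureReal_abs_ge_le {Ω : Type*} [MeasurableSpace Ω] {P : Measure Ω}
    [IsProbabilityMeasure P] {X : Ω → ℝ} {v : NNReal} (hX : HasLaw X (gaussianReal 0 v) P) {s : ℝ}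
    (hs : 0 ≤ s) : P.real {ω | s ≤ |X ω|} ≤ 2 * Real.exp (-s ^ 2 / (2 * v)) := by
  have h := hasSubgaussianMGF_gaussianReal hX
  have h1 := h.measure_ge_le hs
  have h2 := h.neg.measure_ge_le hs
  calc P.real {ω | s ≤ |X ω|} ≤ P.real ({ω | s ≤ X ω} ∪ {ω | s ≤ (-X) ω}) :=
        measureReal_mono fun ω (hω : s ≤ |X ω|) => (le_abs.1 hω : s ≤ X ω ∨ s ≤ -X ω)
    _ ≤ P.real {ω | s ≤ X ω} + P.real {ω | s ≤ (-X) ω} := measureReal_union_le _ _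
    _ ≤ _ := by linarith

variable {m n : ℕ} {Ω : Type*} [MeasurableSpace Ω] {P : Measure Ω} {σ : ℝ}
  {noise : ℕ → Fin m → Ω → Vec n}

theorem GaussianNoise.hasLaw_apply (h : GaussianNoise σ noise P) (k : ℕ) (i : Fin m) (l : Fin n) :
    HasLaw (fun ω => noise k i ω l) (gaussianReal 0 (σ ^ 2).toNNReal) P := by
  have hS : (σ ^ 2 • (1 : Matrix (Fin n) (Fin n) ℝ)).PosSemidef :=
    Matrix.PosSemidef.one.smul (sq_nonneg σ)
  have h1 : HasLaw (fun x : Vec n => x l) (gaussianReal 0 (σ ^ 2).toNNReal)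
      (multivariateGaussian 0 (σ ^ 2 • (1 : Matrix (Fin n) (Fin n) ℝ))) := by
    have h2 := measurePreserving_eval_multivariateGaussian (μ := 0) hS (i := l)
    simpa using h2.hasLaw
  exact h1.comp (h k i)

theorem norm_le_of_forall_abs_le {x : Lifted m n} {s : ℝ} (h : ∀ i l, |x i l| ≤ s) :
    ‖x‖ ^ 2 ≤ m * n * s ^ 2 := by
  rw [PiLp.norm_sq_eq_of_L2]
  calc ∑ i, ‖x i‖ ^ 2 ≤ ∑ _i : Fin m, ∑ _l : Fin n, s ^ 2 := by
        refine Finset.sum_le_sum fun i _ => ?_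
        rw [EuclideanSpace.real_norm_sq_eq]
        refine Finset.sum_le_sum fun l _ => ?_
        rw [← sq_abs]
        gcongr
        exact h i l
    _ = _ := by simp; ring

/-- With high probability, all perturbations up to time `K` are small: union bound over the
coordinates, without any independence. -/
theorem GaussianNoise.measureReal_forall_norm_le (h : GaussianNoise σ noise P)
    [IsProbabilityMeasure P] {r : ℝ} (hr : 0 ≤ r) (hm : 1 ≤ m) (hn : 1 ≤ n) (K : ℕ) :
    1 - K * (m * n * (2 * Real.exp (-(r ^ 2 / (m * n)) / (2 * σ ^ 2)))) ≤
      P.real {ω | ∀ k < K, ‖(WithLp.toLp 2 (fun i => noise k i ω) : Lifted m n)‖ ≤ r} := by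
  -- Per-coordinate threshold: `mn` coordinates of size at most `s` have joint norm at most `r`.
  obtain ⟨s, hs⟩ : ∃ s, s = r / Real.sqrt (m * n) := ⟨_, rfl⟩
  have hmn : (0 : ℝ) < m * n := by positivity
  have hs0 : 0 ≤ s := by rw [hs]; positivity
  have hs2 : s ^ 2 = r ^ 2 / (m * n) := by rw [hs, div_pow, Real.sq_sqrt hmn.le]
  let A := {ω | ∀ k < K, ‖(WithLp.toLp 2 (fun i => noise k i ω) : Lifted m n)‖ ≤ r}
  let B := ⋃ p ∈ (Finset.range K ×ˢ (Finset.univ : Finset (Fin m × Fin n))),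
    {ω | s ≤ |noise p.1 p.2.1 ω p.2.2|}
  have hB : P.real B ≤ K * (m * n * (2 * Real.exp (-(r ^ 2 / (m * n)) / (2 * σ ^ 2)))) := by
    refine (measureReal_biUnion_finset_le _ _).trans ?_
    calc _ ≤ ∑ p ∈ (Finset.range K ×ˢ (Finset.univ : Finset (Fin m × Fin n))),
          2 * Real.exp (-(r ^ 2 / (m * n)) / (2 * σ ^ 2)) := by
          refine Finset.sum_le_sum fun p _ => ?_
          have := measureReal_abs_ge_le (h.hasLaw_apply p.1 p.2.1 p.2.2) hs0
          rwa [hs2, Real.coe_toNNReal _ (sq_nonneg σ)] at this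
      _ = _ := by simp; ring
  -- A covering instead of a complement: subadditivity alone suffices, with no measurability of `A`
  -- or `B`.
  have hAB : (Set.univ : Set Ω) ⊆ A ∪ B := by
    intro ω _
    by_cases hω : ω ∈ B
    · exact Or.inr hω
    refine Or.inl fun k hk => ?_
    simp only [B, Set.mem_iUnion, Finset.mem_product, Finset.mem_range, Finset.mem_univ, and_true,
      Set.mem_ofPred_eq, not_exists, not_le] at hω
    have h1 := norm_le_of_forall_abs_le (x := WithLp.toLp 2 (fun i => noise k i ω)) (s := s)
      fun i l => (hω (k, i, l) hk).le
    rw [hs2, mul_div_cancel₀ _ hmn.ne'] at h1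
    exact le_of_sq_le_sq h1 hr
  have h1 : 1 ≤ P.real A + P.real B := by
    calc (1 : ℝ) = P.real Set.univ := by simp
      _ ≤ P.real (A ∪ B) := measureReal_mono hAB
      _ ≤ _ := measureReal_union_le _ _
  linarith

end Probability

/-! ### Fixed points, contraction and invariance for the update. -/

section Dynamics

variable {m n : ℕ} {W : Matrix (Fin m) (Fin m) ℝ} {f : Fin m → Vec n → ℝ} {α C : ℝ}

/-- The noiseless update `x ↦ (W ⊗ Iₙ) x - α ∇F(x)`. -/
noncomputable def step (W : Matrix (Fin m) (Fin m) ℝ) (f : Fin m → Vec n → ℝ) (α : ℝ)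
    (x : Lifted m n) : Lifted m n :=
  liftMatrix n W x - α • gradient (liftedObjective f) x

theorem step_apply (hf : ∀ i, ContDiff ℝ 2 (f i)) (x : Lifted m n) (i : Fin m) :
    step W f α x i = ∑ j, W i j • x j - α • gradient (f i) (x i) := by
  rw [step, gradient_liftedObjective hf, PiLp.sub_apply, liftMatrix_apply]
  rfl

theorem iterate_succ_eq (hf : ∀ i, ContDiff ℝ 2 (f i)) (x₀ : Lifted m n)
    (ν : ℕ → Fin m → Vec n) (k : ℕ) : iterate W f α x₀ ν (k + 1) =
      step W f α (iterate W f α x₀ ν k) - α • WithLp.toLp 2 (ν k) := by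
  refine PiLp.ext fun i => ?_
  rw [PiLp.sub_apply, step_apply hf, PiLp.smul_apply, sub_sub, ← smul_add]
  rfl

theorem IsMixing.sum_row (hW : IsMixing W) (i : Fin m) : ∑ j, W i j = 1 := by
  have := congrFun hW.mulVec_one i
  simpa [Matrix.mulVec, dotProduct] using this

theorem IsMixing.sum_col (hW : IsMixing W) (j : Fin m) : ∑ i, W i j = 1 := by
  rw [← hW.sum_row j]
  refine Finset.sum_congr rfl fun i _ => ?_
  conv_rhs => rw [← hW.symm]
  rfl

theorem IsMixing.inner_le (hW : IsMixing W) (x : Lifted m n) :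
    inner ℝ (liftMatrix n W x) x ≤ ‖x‖ ^ 2 := by
  have h := matLambdaMin_mul_le_inner (n := n) (A := 1 - W) (by simp [hW.symm]) x
  rw [liftMatrix_one_sub, inner_sub_left, real_inner_self_eq_norm_sq] at h
  nlinarith [mul_nonneg hW.le_one (sq_nonneg ‖x‖)]

theorem IsMixing.liftMatrix_consensus (hW : IsMixing W) (u : Vec n) :
    liftMatrix n W (consensus m u) = consensus m u := by
  refine PiLp.ext fun i => ?_
  rw [liftMatrix_apply]
  simp only [consensus]
  rw [← Finset.sum_smul, hW.sum_row, one_smul]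

theorem step_eq_self_of_gradient_Q (hf : ∀ i, ContDiff ℝ 2 (f i)) (hW : IsMixing W)
    (hα : 0 < α) {z : Lifted m n} (hz : gradient (Q W f α) z = 0) : step W f α z = z := by
  rw [gradient_Q hf hW.symm] at hz
  simp only [liftMatrix_one_sub] at hz
  have h : α • (gradient (liftedObjective f) z + (1 / α) • (z - liftMatrix n W z)) = 0 := by
    rw [hz, smul_zero]
  rw [smul_add, smul_smul, mul_one_div_cancel hα.ne', one_smul] at h
  rw [step, ← sub_eq_zero, ← neg_eq_zero, ← h]
  abel

theorem step_eq_self_of_sum (hf : ∀ i, ContDiff ℝ 2 (f i)) (hW : IsMixing W) {x : Lifted m n}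
    (hx : ∀ i, ∑ j, W i j • (x j - x i) = α • gradient (f i) (x i)) : step W f α x = x := by
  refine PiLp.ext fun i => ?_
  have h := hx i
  simp only [smul_sub, Finset.sum_sub_distrib] at h
  rw [← Finset.sum_smul, hW.sum_row, one_smul] at h
  rw [step_apply hf, ← h, sub_sub_cancel]

/-- Summing the fixed-point equation over the agents cancels the mixing terms, since the columns of
`W` sum to one. -/
theorem sum_gradient_eq_zero (hf : ∀ i, ContDiff ℝ 2 (f i)) (hW : IsMixing W) (hα : 0 < α)
    {z : Lifted m n} (hz : step W f α z = z) : ∑ i, gradient (f i) (z i) = 0 := by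
  have h1 : ∀ i, α • gradient (f i) (z i) = ∑ j, W i j • z j - z i := fun i => by
    have h := step_apply (W := W) (α := α) hf z i
    rw [hz] at h
    rwa [eq_sub_iff_add_eq, add_comm, ← eq_sub_iff_add_eq]
  have h2 : α • ∑ i, gradient (f i) (z i) = 0 := by
    rw [Finset.smul_sum, Finset.sum_congr rfl fun i _ => h1 i, Finset.sum_sub_distrib,
      Finset.sum_comm]
    simp_rw [← Finset.sum_smul, hW.sum_col, one_smul, sub_self]
  exact (smul_eq_zero.1 h2).resolve_left hα.ne'

/-- At a local minimizer of `Q_α` the sum of the Hessians is positive semidefinite. -/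
theorem inner_sum_hessian_nonneg (hf : ∀ i, ContDiff ℝ 2 (f i)) (hW : IsMixing W)
    {z : Lifted m n} (hz : 0 < lambdaMin (hessian (Q W f α) z : Lifted m n →ₗ[ℝ] Lifted m n))
    (u : Vec n) : 0 ≤ inner ℝ ((∑ i, hessian (f i) (z i)) u) u := by
  -- Consensual test vectors are fixed by `W ⊗ I`, so the penalty in `Q_α` contributes nothing.
  have h1 := lambdaMin_mul_norm_sq_le_inner (hessian_symm (contDiff_Q (W := W) hf α) z)
    (consensus m u)
  have h2 : 0 ≤ inner ℝ (hessian (Q W f α) z (consensus m u)) (consensus m u) :=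
    (mul_nonneg hz.le (sq_nonneg _)).trans h1
  rw [hessian_Q hf hW.symm, add_apply, smul_apply,
    liftMatrix_one_sub, hW.liftMatrix_consensus, sub_self, smul_zero, add_zero,
    PiLp.inner_apply] at h2
  rw [sum_apply, sum_inner]
  refine h2.trans_eq (Finset.sum_congr rfl fun i _ => ?_)
  rw [hessian_liftedObjective_apply hf]
  rfl

theorem norm_sum_sub_le {V : Type*} [NormedAddCommGroup V] {g : Fin m → Vec n → V}
    (hg : ∀ i x y, ‖g i x - g i y‖ ≤ C * ‖x - y‖) (hC : 0 ≤ C) (x z : Lifted m n) :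
    ‖∑ i, g i (x i) - ∑ i, g i (z i)‖ ≤ m * C * ‖x - z‖ := by
  rw [← Finset.sum_sub_distrib]
  calc ‖∑ i, (g i (x i) - g i (z i))‖ ≤ ∑ _i : Fin m, C * ‖x - z‖ := by
        refine norm_sum_le_of_le _ fun i _ => (hg i _ _).trans ?_
        gcongr
        exact PiLp.norm_apply_le (x - z) i
    _ = _ := by simp; ring

/-- On a ball where `∇²F ≽ μ`, the noiseless update contracts with factor `1 - αμ`. -/
theorem norm_step_sub_le (hf : ∀ i, ContDiff ℝ 2 (f i)) (hW : IsMixing W) (hα : 0 < α)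
    (hC : 0 ≤ C) (hLip : ∀ i x y, ‖gradient (f i) x - gradient (f i) y‖ ≤ C * ‖x - y‖)
    (hαC : α * C ≤ matLambdaMin W) {c : Lifted m n} {R μ : ℝ}
    (hμ : ∀ y : Lifted m n, ‖y - c‖ ≤ R →
      μ ≤ lambdaMin (hessian (liftedObjective f) y : Lifted m n →ₗ[ℝ] Lifted m n))
    {x y : Lifted m n} (hx : ‖x - c‖ ≤ R) (hy : ‖y - c‖ ≤ R) :
    ‖step W f α x - step W f α y‖ ≤ (1 - α * μ) * ‖x - y‖ := by
  rcases eq_or_ne x y with rfl | hxy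
  · simp
  have hF := contDiff_liftedObjective hf
  have hlow : ∀ z : Lifted m n, ‖z - c‖ ≤ R → ∀ v : Lifted m n,
      μ * ‖v‖ ^ 2 ≤ inner ℝ (hessian (liftedObjective f) z v) v := fun z hz v =>
    (mul_le_mul_of_nonneg_right (hμ z hz) (sq_nonneg _)).trans
      (lambdaMin_mul_norm_sq_le_inner (hessian_symm hF z) v)
  have hinner : ∀ z v : Lifted m n,
      inner ℝ ((liftMatrix n W - α • hessian (liftedObjective f) z) v) v =
      inner ℝ (liftMatrix n W v) v - α * inner ℝ (hessian (liftedObjective f) z v) v := by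
    intro z v
    rw [sub_apply, smul_apply, inner_sub_left, real_inner_smul_left]
  -- Since `αC ≤ λ_min(W)`, the mixing term dominates `α∇²F`.
  have h0 : ∀ z v : Lifted m n,
      0 ≤ inner ℝ ((liftMatrix n W - α • hessian (liftedObjective f) z) v) v := by
    intro z v
    rw [hinner]
    have h1 := matLambdaMin_mul_le_inner (n := n) hW.symm v
    have h2 := mul_le_mul_of_nonneg_left (inner_hessian_liftedObjective_le hf hC hLip z v) hα.le
    have h3 := mul_le_mul_of_nonneg_right hαC (sq_nonneg ‖v‖)
    linarith
  have h1 : ∀ z : Lifted m n, ‖z - c‖ ≤ R → ∀ v : Lifted m n,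
      inner ℝ ((liftMatrix n W - α • hessian (liftedObjective f) z) v) v ≤
        (1 - α * μ) * ‖v‖ ^ 2 := by
    intro z hz v
    rw [hinner]
    have h1 := hW.inner_le v
    have h2 := mul_le_mul_of_nonneg_left (hlow z hz v) hα.le
    linarith
  -- Forced by `h0` and `h1` at the nonzero vector `x - y`; hence the case `x = y` was split off.
  have hαμ : 0 ≤ 1 - α * μ := by
    have hpos : 0 < ‖x - y‖ ^ 2 := by
      have := norm_pos_iff.2 (sub_ne_zero.2 hxy)
      positivity
    exact nonneg_of_mul_nonneg_left ((h0 x _).trans (h1 x hx (x - y))) hpos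
  refine (convex_closedBall c R).norm_image_sub_le_of_norm_hasFDerivWithin_le
    (f' := fun z => liftMatrix n W - α • hessian (liftedObjective f) z) (fun z _ => ?_)
    (fun z hz => ?_) (mem_closedBall_iff_norm.2 hy) (mem_closedBall_iff_norm.2 hx)
  · exact ((liftMatrix n W).hasFDerivAt.sub
      ((hasFDerivAt_gradient hF z).const_smul α)).hasFDerivWithinAt
  · refine opNorm_le_of_inner_le (fun v w => ?_) hαμ (h0 z) (h1 z (mem_closedBall_iff_norm.1 hz))
    rw [sub_apply, sub_apply, smul_apply, smul_apply, inner_sub_left, inner_sub_right,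
      real_inner_smul_left, real_inner_smul_right, liftMatrix_symm hW.symm, hessian_symm hF]

theorem eq_of_step_eq_self {c : Lifted m n} {κ R : ℝ} (hκ : κ < 1)
    (hstep : ∀ x y : Lifted m n, ‖x - c‖ ≤ R → ‖y - c‖ ≤ R →
      ‖step W f α x - step W f α y‖ ≤ κ * ‖x - y‖)
    {x y : Lifted m n} (hx : ‖x - c‖ ≤ R) (hy : ‖y - c‖ ≤ R) (hxs : step W f α x = x)
    (hys : step W f α y = y) : x = y := by
  have h := hstep x y hx hy
  rw [hxs, hys] at h
  have : ‖x - y‖ ≤ 0 := by nlinarith [norm_nonneg (x - y)]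
  exact sub_eq_zero.1 (norm_le_zero_iff.1 this)

/-- The radius `r / μ` balances contraction against noise: `(1 - αμ) r/μ + αr = r/μ`. -/
theorem norm_iterate_sub_le (hf : ∀ i, ContDiff ℝ 2 (f i)) {z x₀ : Lifted m n} {μ r : ℝ}
    (hα : 0 < α) (hμ : 0 < μ) (hz : step W f α z = z)
    (hstep : ∀ x : Lifted m n, ‖x - z‖ ≤ r / μ →
      ‖step W f α x - step W f α z‖ ≤ (1 - α * μ) * ‖x - z‖) (hαμ : α * μ ≤ 1)
    (hx₀ : ‖x₀ - z‖ ≤ r / μ) {ν : ℕ → Fin m → Vec n} {K : ℕ}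
    (hν : ∀ k < K, ‖(WithLp.toLp 2 (ν k) : Lifted m n)‖ ≤ r) :
    ∀ k ≤ K, ‖iterate W f α x₀ ν k - z‖ ≤ r / μ := by
  intro k
  induction k with
  | zero => exact fun _ => hx₀
  | succ k ih =>
    intro hk
    have h1 := ih (by omega)
    have h2 := hstep _ h1
    rw [hz] at h2
    rw [iterate_succ_eq hf]
    calc ‖step W f α (iterate W f α x₀ ν k) - α • WithLp.toLp 2 (ν k) - z‖
        = ‖(step W f α (iterate W f α x₀ ν k) - z) - α • WithLp.toLp 2 (ν k)‖ := by
          rw [sub_right_comm]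
      _ ≤ ‖step W f α (iterate W f α x₀ ν k) - z‖ + ‖α • WithLp.toLp 2 (ν k)‖ := norm_sub_le _ _
      _ ≤ (1 - α * μ) * (r / μ) + α * r := by
          rw [norm_smul, Real.norm_of_nonneg hα.le]
          have h3 : 0 ≤ 1 - α * μ := by linarith
          have h4 := hν k (by omega)
          gcongr
          exact h2.trans (by gcongr)
      _ = r / μ := by field_simp; ring

end Dynamics

/-! ### Step size and noise level as functions of `ρ`. -/

section Parameters

theorem le_maxConst {m : ℕ} (L : Fin m → ℝ) (i : Fin m) : L i ≤ maxConst L :=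
  le_ciSup (Set.finite_range L).bddAbove i

theorem stepSize_le {m : ℕ} {W : Matrix (Fin m) (Fin m) ℝ} (hW : IsMixing W) {Lg : Fin m → ℝ}
    (hLg : 0 < maxConst Lg) {ρ : ℝ} (hρ : 1 ≤ ρ) :
    stepSize W Lg ρ ≤ matLambdaMin W / maxConst Lg := by
  have h : Real.sqrt (1 / ρ) ≤ 1 :=
    Real.sqrt_le_one.2 ((div_le_one (by linarith)).2 hρ)
  exact mul_le_of_le_one_right (div_pos hW.pos hLg).le h

theorem tendsto_stepSize {m : ℕ} (W : Matrix (Fin m) (Fin m) ℝ) (Lg : Fin m → ℝ) :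
    Filter.Tendsto (stepSize W Lg) Filter.atTop (nhds 0) := by
  have h : Filter.Tendsto (fun ρ : ℝ => matLambdaMin W / maxConst Lg * Real.sqrt (1 / ρ))
      Filter.atTop (nhds (matLambdaMin W / maxConst Lg * Real.sqrt 0)) :=
    ((Real.continuous_sqrt.tendsto 0).comp
      (tendsto_const_nhds.div_atTop Filter.tendsto_id)).const_mul _
  rwa [Real.sqrt_zero, mul_zero] at h

/-- The exponent equals `-3200 L² ρ⁶ / α`, and for large `ρ` this is at most `-2ρ`; one `ρ` absorbs
the factor `2mn`, the other remains. -/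
theorem gaussian_tail_le {m n : ℕ} (hm : 1 ≤ m) (hn : 1 ≤ n) {α a L ρ : ℝ} (hα : 0 < α)
    (hαa : α ≤ a) (hL : 0 < L) (hρ1 : 1 ≤ ρ) (hρ2 : Real.log (2 * (m * n)) ≤ ρ)
    (hρ3 : a / (1600 * L ^ 2) ≤ ρ) :
    m * n * (2 * Real.exp (-((2 * Real.sqrt α) ^ 2 / (m * n)) /
      (2 * (1 / (40 * Real.sqrt (m * n) * L) * α * (1 / ρ) ^ 3) ^ 2))) ≤ Real.exp (-ρ) := by
  have hmn : (0 : ℝ) < m * n := by positivity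
  have hρ0 : 0 < ρ := by linarith
  have hexp : -((2 * Real.sqrt α) ^ 2 / (m * n)) /
      (2 * (1 / (40 * Real.sqrt (m * n) * L) * α * (1 / ρ) ^ 3) ^ 2) =
      -(3200 * L ^ 2 * ρ ^ 6 / α) := by
    rw [mul_pow 2, Real.sq_sqrt hα.le]
    have h := Real.sq_sqrt hmn.le
    have h' : 0 < Real.sqrt (m * n) := Real.sqrt_pos.2 hmn
    have h1 : (1 / (40 * Real.sqrt (m * n) * L) * α * (1 / ρ) ^ 3) ^ 2 =
        α ^ 2 / (1600 * (m * n) * L ^ 2 * ρ ^ 6) := by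
      rw [mul_pow, mul_pow, div_pow, mul_pow, mul_pow, h]
      field_simp
      norm_num
    rw [h1]
    field_simp
    norm_num
  have h1 : 2 * ρ ≤ 3200 * L ^ 2 * ρ ^ 6 / α := by
    rw [le_div_iff₀ hα]
    rw [div_le_iff₀ (by positivity)] at hρ3
    have h2 : ρ ^ 2 ≤ ρ ^ 6 := pow_le_pow_right₀ hρ1 (by norm_num)
    calc 2 * ρ * α ≤ 2 * ρ * (ρ * (1600 * L ^ 2)) := by gcongr; exact hαa.trans hρ3
      _ = 3200 * L ^ 2 * ρ ^ 2 := by ring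
      _ ≤ _ := by gcongr
  rw [hexp]
  calc m * n * (2 * Real.exp (-(3200 * L ^ 2 * ρ ^ 6 / α)))
      = Real.exp (Real.log (2 * (m * n)) - 3200 * L ^ 2 * ρ ^ 6 / α) := by
        rw [sub_eq_add_neg, Real.exp_add, Real.exp_log (by positivity)]; ring
    _ ≤ _ := Real.exp_le_exp.2 (by linarith)

end Parameters

/-! ### Local regularity near a minimizer of `Q_α`. -/

section LocalRegularity

variable {m n : ℕ} {W : Matrix (Fin m) (Fin m) ℝ} {f : Fin m → Vec n → ℝ}

/-- Close to a local minimizer of `Q_α` the first two alternatives of local regularity fail. -/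
theorem LocalRegularity.exists_critical (hf : ∀ i, ContDiff ℝ 2 (f i)) (hW : IsMixing W)
    {α' γ δ ε η μ α Cg CH d : ℝ} (hreg : LocalRegularity W f α' γ δ ε η μ) (hγ : 0 < γ)
    (hα : 0 < α) (hα' : α ≤ α') (hCg : 0 ≤ Cg) (hCH : 0 ≤ CH)
    (hg : ∀ i x y, ‖gradient (f i) x - gradient (f i) y‖ ≤ Cg * ‖x - y‖)
    (hH : ∀ i x y, ‖hessian (f i) x - hessian (f i) y‖ ≤ CH * ‖x - y‖)
    (hdε : m * Cg * d ≤ ε) (hdγ : m * CH * d ≤ γ) {x z : Lifted m n}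
    (hx : ‖x - consensus m (av x)‖ ≤ η) (hz : z ∈ localMinimizers (Q W f α))
    (hxz : ‖x - z‖ ≤ d) :
    ∃ x' : Lifted m n, ‖x' - x‖ ≤ δ ∧ step W f α x' = x' ∧
      ∀ y : Lifted m n, ‖y - x'‖ ≤ 3 * δ →
        μ ≤ lambdaMin (hessian (liftedObjective f) y : Lifted m n →ₗ[ℝ] Lifted m n) := by
  -- In (a) and (b), the sum at `x` differs from that at `z` by at most `ε`, respectively `γ`,
  -- contradicting the first- and second-order conditions at `z`.
  rcases hreg x hx with h | h | h
  · exfalso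
    have h1 := norm_sum_sub_le hg hCg x z
    rw [sum_gradient_eq_zero hf hW hα (step_eq_self_of_gradient_Q hf hW hα hz.1), sub_zero] at h1
    have h2 : m * Cg * ‖x - z‖ ≤ m * Cg * d := by gcongr
    linarith
  · exfalso
    obtain ⟨u, hu, hlt⟩ := exists_inner_lt_of_lambdaMin_lt (neg_nonpos.2 hγ.le) h
    have h1 := norm_sum_sub_le hH hCH x z
    have h2 : m * CH * ‖x - z‖ ≤ m * CH * d := by gcongr
    have h3 := inner_sum_hessian_nonneg hf hW hz.2 u
    have h4 : |inner ℝ ((∑ i, hessian (f i) (x i) - ∑ i, hessian (f i) (z i)) u) u| ≤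
        γ * ‖u‖ ^ 2 := by
      calc _ ≤ ‖(∑ i, hessian (f i) (x i) - ∑ i, hessian (f i) (z i)) u‖ * ‖u‖ :=
            abs_real_inner_le_norm _ _
        _ ≤ γ * ‖u‖ * ‖u‖ := by
            gcongr
            exact (ContinuousLinearMap.le_opNorm _ _).trans (by gcongr; linarith)
        _ = _ := by ring
    rw [sub_apply, inner_sub_left] at h4
    linarith [(abs_le.1 h4).1]
  · obtain ⟨x', h1, h2, h3⟩ := h α hα hα'
    exact ⟨x', h1, step_eq_self_of_sum hf hW h2, h3⟩

end LocalRegularity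

end NDGD

/-! ### The main theorem. -/

theorem mainTheorem3 {m n : ℕ} (hm : 1 ≤ m) (hn : 1 ≤ n)
    (W : Matrix (Fin m) (Fin m) ℝ) (hW : NDGD.IsMixing W)
    (f : Fin m → NDGD.Vec n → ℝ) (hf : ∀ i, ContDiff ℝ 2 (f i))
    (Lg LH : Fin m → ℝ) (hLg : 0 < NDGD.maxConst Lg) (hLH : 0 < NDGD.maxConst LH)
    (hLip : NDGD.LipschitzAssumption f Lg LH)
    (hcoer : NDGD.CoercivityAssumption f)
    (α' γ δ ε η μ : ℝ) (hα' : 0 < α') (hγ : 0 < γ) (hδ : 0 < δ) (hε : 0 < ε)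
    (hη : 0 < η) (hμ : 0 < μ)
    (hreg : NDGD.LocalRegularity W f α' γ δ ε η μ) :
    ∃ ρ₄ : ℝ, 1 ≤ ρ₄ ∧ ∀ ρ : ℝ, ρ₄ ≤ ρ →
      ∀ α σ : ℝ, α = NDGD.stepSize W Lg ρ → σ = NDGD.noiseLevel n W Lg LH ρ →
        (0 < α ∧ α ≤ α') ∧
        Real.sqrt α / μ ≤ δ ∧
        ∀ x₀ : NDGD.Lifted m n,
          ‖x₀ - NDGD.consensus m (NDGD.av x₀)‖ ≤ η →
          Metric.infEDist x₀ (NDGD.localMinimizers (NDGD.Q W f α)) ≤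
            ENNReal.ofReal (Real.sqrt α / μ) →
          ∀ K : ℕ, K = NDGD.numIter W f α ρ x₀ →
          ∃ xs ∈ NDGD.localMinimizers (NDGD.Q W f α),
            ‖x₀ - xs‖ ≤ Real.sqrt α / μ ∧
            ∀ (Ω : Type*) [MeasurableSpace Ω] (P : Measure Ω) [IsProbabilityMeasure P]
              (noise : ℕ → Fin m → Ω → NDGD.Vec n),
              NDGD.GaussianNoise σ noise P →
              1 - (K : ℝ) * ((K : ℝ) + 1) * Real.exp (-ρ) ≤
                P.real {ω | ∀ k : ℕ, 0 < k → k ≤ K →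
                  ‖NDGD.iterate W f α x₀ (fun t i => noise t i ω) k - xs‖
                    ≤ 2 / μ * Real.sqrt α} := by
  have hg : ∀ i x y, ‖gradient (f i) x - gradient (f i) y‖ ≤ NDGD.maxConst Lg * ‖x - y‖ :=
    fun i x y => (hLip i x y).1.trans
      (mul_le_mul_of_nonneg_right (NDGD.le_maxConst Lg i) (norm_nonneg _))
  have hH : ∀ i x y, ‖NDGD.hessian (f i) x - NDGD.hessian (f i) y‖ ≤
      NDGD.maxConst LH * ‖x - y‖ := fun i x y => (hLip i x y).2.trans
    (mul_le_mul_of_nonneg_right (NDGD.le_maxConst LH i) (norm_nonneg _))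
  have ht := NDGD.tendsto_stepSize W Lg
  have hr : Filter.Tendsto (fun ρ => Real.sqrt (NDGD.stepSize W Lg ρ) / μ) Filter.atTop
      (nhds 0) := by
    simpa using ((Real.continuous_sqrt.tendsto 0).comp ht).div_const μ
  have hd : ∀ c : ℝ, Filter.Tendsto
      (fun ρ => c * (2 * (Real.sqrt (NDGD.stepSize W Lg ρ) / μ))) Filter.atTop (nhds 0) :=
    fun c => by simpa using (hr.const_mul 2).const_mul c
  -- Smallness is imposed at distance `2√α/μ`, not `√α/μ`, as the infimum distance is not yet known
  -- to be attained.
  have hev : ∀ᶠ ρ : ℝ in Filter.atTop, 1 ≤ ρ ∧ NDGD.stepSize W Lg ρ ≤ α' ∧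
      NDGD.stepSize W Lg ρ ≤ 1 / μ ∧ Real.sqrt (NDGD.stepSize W Lg ρ) / μ ≤ δ ∧
      m * NDGD.maxConst Lg * (2 * (Real.sqrt (NDGD.stepSize W Lg ρ) / μ)) ≤ ε ∧
      m * NDGD.maxConst LH * (2 * (Real.sqrt (NDGD.stepSize W Lg ρ) / μ)) ≤ γ ∧
      Real.log (2 * (m * n)) ≤ ρ ∧
      NDGD.matLambdaMin W / NDGD.maxConst Lg / (1600 * NDGD.maxConst LH ^ 2) ≤ ρ := by
    filter_upwards [Filter.eventually_ge_atTop 1, ht.eventually_le_const hα',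
      ht.eventually_le_const (one_div_pos.2 hμ), hr.eventually_le_const hδ,
      (hd (m * NDGD.maxConst Lg)).eventually_le_const hε,
      (hd (m * NDGD.maxConst LH)).eventually_le_const hγ,
      Filter.eventually_ge_atTop (Real.log (2 * (m * n))),
      Filter.eventually_ge_atTop
        (NDGD.matLambdaMin W / NDGD.maxConst Lg / (1600 * NDGD.maxConst LH ^ 2))]
      with ρ h1 h2 h3 h4 h5 h6 h7 h8
    exact ⟨h1, h2, h3, h4, h5, h6, h7, h8⟩
  obtain ⟨ρ₀, hρ₀⟩ := Filter.eventually_atTop.1 hev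
  refine ⟨max 1 ρ₀, le_max_left _ _, fun ρ hρ α σ hα hσ => ?_⟩
  obtain ⟨hρ1, hα1, hαμ, hrδ, hdε, hdγ, hρ2, hρ3⟩ := hρ₀ ρ ((le_max_right _ _).trans hρ)
  rw [← hα] at hα1 hαμ hrδ hdε hdγ
  have hρpos : 0 < ρ := by linarith
  have hαa : α ≤ NDGD.matLambdaMin W / NDGD.maxConst Lg := hα ▸ NDGD.stepSize_le hW hLg hρ1
  have hα0 : 0 < α := by
    rw [hα]
    exact mul_pos (div_pos hW.pos hLg) (Real.sqrt_pos.2 (one_div_pos.2 hρpos))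
  rw [le_div_iff₀ hμ] at hαμ
  refine ⟨⟨hα0, hα1⟩, hrδ, fun x₀ hx₀ hdist K _ => ?_⟩
  obtain ⟨r, hr_def⟩ : ∃ r, r = Real.sqrt α / μ := ⟨_, rfl⟩
  rw [← hr_def] at hrδ hdε hdγ hdist ⊢
  have hr0 : 0 < r := hr_def ▸ div_pos (Real.sqrt_pos.2 hα0) hμ
  obtain ⟨z, hz, hxz⟩ : ∃ z ∈ NDGD.localMinimizers (NDGD.Q W f α), ‖x₀ - z‖ < 2 * r := by
    obtain ⟨z, hz, hzr⟩ := Metric.infEDist_lt_iff.1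
      (hdist.trans_lt ((ENNReal.ofReal_lt_ofReal_iff (by linarith)).2 (by linarith : r < 2 * r)))
    rw [edist_dist, ENNReal.ofReal_lt_ofReal_iff (by linarith), dist_eq_norm] at hzr
    exact ⟨z, hz, hzr⟩
  obtain ⟨x', hx', hfix, hconv⟩ := hreg.exists_critical hf hW hγ hα0 hα1 hLg.le hLH.le hg hH
    hdε hdγ hx₀ hz hxz.le
  have hcontr : ∀ x y : NDGD.Lifted m n, ‖x - x'‖ ≤ 3 * δ → ‖y - x'‖ ≤ 3 * δ →
      ‖NDGD.step W f α x - NDGD.step W f α y‖ ≤ (1 - α * μ) * ‖x - y‖ := fun x y hx hy =>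
    NDGD.norm_step_sub_le hf hW hα0 hLg.le hg ((le_div_iff₀ hLg).1 hαa) hconv hx hy
  -- Here `‖y - x'‖ ≤ 2r + δ ≤ 3δ`, so `y` lies in the contraction ball.
  have huniq : ∀ y ∈ NDGD.localMinimizers (NDGD.Q W f α), ‖x₀ - y‖ < 2 * r → y = x' := by
    intro y hy hxy
    refine NDGD.eq_of_step_eq_self (κ := 1 - α * μ) (by nlinarith [mul_pos hα0 hμ]) hcontr ?_
      (by rw [sub_self, norm_zero]; linarith)
      (NDGD.step_eq_self_of_gradient_Q hf hW hα0 hy.1) hfix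
    calc ‖y - x'‖ ≤ ‖y - x₀‖ + ‖x₀ - x'‖ := norm_sub_le_norm_sub_add_norm_sub _ _ _
      _ ≤ 3 * δ := by rw [norm_sub_rev y, norm_sub_rev x₀ x']; linarith
  -- Every minimizer within `2r` is `x'`, so the infimum is attained there. Were `x'` farther than
  -- `r`, a minimizer strictly closer than `x'` would exist and equal `x'`.
  have hx'r : ‖x₀ - x'‖ ≤ r := by
    by_contra! hlt
    obtain ⟨y, hy, hyr⟩ := Metric.infEDist_lt_iff.1 (hdist.trans_lt
      ((ENNReal.ofReal_lt_ofReal_iff (hr0.trans (lt_min hlt (by linarith)))).2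
        (lt_min hlt (by linarith : r < 2 * r))))
    rw [edist_dist, ENNReal.ofReal_lt_ofReal_iff (hr0.trans (lt_min hlt (by linarith))),
      dist_eq_norm] at hyr
    have hyx' := huniq y hy (hyr.trans_le (min_le_right _ _))
    rw [hyx'] at hyr
    exact lt_irrefl _ (hyr.trans_le (min_le_left _ _))
  refine ⟨x', huniq z hz hxz ▸ hz, hx'r, fun Ω _ P _ noise hnoise => ?_⟩
  have h2r : 2 * Real.sqrt α / μ = 2 * r := by rw [hr_def, mul_div_assoc]
  have hsub : {ω | ∀ k < K, ‖(WithLp.toLp 2 (fun i => noise k i ω) : NDGD.Lifted m n)‖ ≤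
      2 * Real.sqrt α} ⊆ {ω | ∀ k : ℕ, 0 < k → k ≤ K →
        ‖NDGD.iterate W f α x₀ (fun t i => noise t i ω) k - x'‖ ≤ 2 / μ * Real.sqrt α} := by
    intro ω hω k _ hk
    rw [div_mul_eq_mul_div]
    refine NDGD.norm_iterate_sub_le hf hα0 hμ hfix (fun x hx => hcontr x x' ?_ ?_) hαμ ?_
      (fun k hk => hω k hk) k hk
    · rw [h2r] at hx; linarith
    · rw [sub_self, norm_zero]; linarith
    · rw [h2r]; linarith
  refine le_trans ?_ ((hnoise.measureReal_forall_norm_le (by positivity) hm hn K).trans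
    (measureReal_mono hsub))
  have htail := NDGD.gaussian_tail_le hm hn hα0 hαa hLH hρ1 hρ2 hρ3
  have hσ' : σ = 1 / (40 * Real.sqrt (m * n) * NDGD.maxConst LH) * α * (1 / ρ) ^ 3 := by
    rw [hσ, hα, NDGD.noiseLevel]
  rw [← hσ'] at htail
  have h1 := mul_le_mul_of_nonneg_left htail (Nat.cast_nonneg (α := ℝ) K)
  -- The union bound gives the stronger `K e^{-ρ}`.
  have h2 : (K : ℝ) * Real.exp (-ρ) ≤ K * (K + 1) * Real.exp (-ρ) := by
    gcongr
    nlinarith [Nat.cast_nonneg (α := ℝ) K, sq_nonneg (K : ℝ)]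
  linarith
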